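/- Conventions. Let $\varphi:M\times\mathbb R\to M$ be a continuous flow, written $xt=\varphi(x,t)$, with $\gamma^{+}(x)=\{xt: t\ge 0\}$, $\gamma^{-}(x)=\{xt: t\le 0\}$, $\omega(x)=\bigcap_{t>0}\overline{x[t,\infty)}$ and $\omega^{*}(x)=\bigcap_{t<0}\overline{x(-\infty,t]}$. A compact invariant set $K$ is *isolated* if it is the maximal invariant subset of some compact neighborhood of itself. It is *saddle* if it has a neighborhood $U$ such that every neighborhood of $K$ contains a point $x$ with $\gamma^{+}(x)\not\subset U$ and $\gamma^{-}(x)\not\subset U$; otherwise it is *non-saddle* (so $\emptyset$ is isolated and non-saddle). Put $\mathcal A(K)=\{x:\emptyset\ne\omega(x)\subset K\}$, $\mathcal R(K)=\{x:\emptyset\neq\omega^{*}(x)\subset K\}$ and $\mathcal I(K)=\mathcal A(K)\cup\mathcal R(K)$ (the region of influence). The points of $(\mathcal A(K)\cap\mathcal R(K))-K$ are called *homoclinic*. A point $x\notin\mathcal I(K)$ is *externally dissonant* if there are sequences $x_n\to x$, $t_n\to\infty$, $s_n\to-\infty$ such that $x_nt_n$ and $x_ns_n$ converge to points of $K$. The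 set $K$ is *stable* if every neighborhood $U$ of $K$ contains a neighborhood $V$ of $K$ with $\gamma^{+}(x)\subset U$ for all $x\in V$; an *unstable global attractor* is an isolated invariant compactum $K$ with $\mathcal A(K)=M$ that is not stable. An ANR is a metrizable space $M$ such that, whenever $h$ is a homeomorphism of $M$ onto a closed subset of a metrizable space $Y$, $h(M)$ is a retract of some neighborhood of $h(M)$ in $Y$. Theorem. Let $K$ be a connected isolated non-saddle set, $\emptyset\neq K\subsetneq M$, of a flow on a compact and connected ANR $M$, and let $L=M-\mathcal I(K)$. Then: 1. $L$ is an isolated invariant compactum, and it is non-empty when $K$ is not an unstable global attractor. 2. A connected component of $L$ is saddle if and only if it contains an externally dissonant point of $K$. 3. The union $L_s$ of the saddle components of $L$ is an isolated invariant compactum, which is saddle if it is non-empty. 4. $L_n=L-L_s$ is an isolated non-saddle (invariant) compactum. 5. If $x\in\mathcal I(K)-K$ is not homoclinic and the connected component of $\mathcal I(K)-K$ containing $x$ contains homoclinic points, then $\omega(x)\subset L_s$ or $\omega^{*}(x)\subset L_s$. -/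

import Mathlib

open Set Filter Topology

namespace NonSaddle

universe u

/-- A space is an absolute neighborhood retract (for metrizable spaces) if it is metrizable and
each of its homeomorphic closed images in a metrizable space `Y` is a retract of a neighborhood
in `Y`. -/
def IsANR (X : Type u) [TopologicalSpace X] : Prop :=
  TopologicalSpace.MetrizableSpace X ∧
    ∀ (Y : Type u) [TopologicalSpace Y] [TopologicalSpace.MetrizableSpace Y] (h : X → Y),
      IsClosedEmbedding h →
        ∃ U ∈ 𝓝ˢ (range h), ∃ r : Y → Y,
          ContinuousOn r U ∧ MapsTo r U (range h) ∧ ∀ y ∈ range h, r y = y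

/-- The connected components of a subset `F` of a space. -/
def componentsOf {X : Type u} [TopologicalSpace X] (F : Set X) : Set (Set X) :=
  {C | ∃ x ∈ F, C = connectedComponentIn F x}

variable {M : Type u} [TopologicalSpace M]

/-- The positive semi-trajectory of `x`. -/
def posTraj (φ : Flow ℝ M) (x : M) : Set M := {y | ∃ t : ℝ, 0 ≤ t ∧ y = φ t x}

/-- The negative semi-trajectory of `x`. -/
def negTraj (φ : Flow ℝ M) (x : M) : Set M := {y | ∃ t : ℝ, t ≤ 0 ∧ y = φ t x}

/-- The omega-limit `ω(x)`. -/
def omegaPos (φ : Flow ℝ M) (x : M) : Set M := omegaLimit atTop φ {x}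

/-- The negative omega-limit `ω*(x)`. -/
def omegaNeg (φ : Flow ℝ M) (x : M) : Set M := omegaLimit atBot φ {x}

/-- Isolated invariant compacta: compact invariant sets that are the maximal invariant subset of
some compact neighborhood of themselves. -/
def IsIsolatedInvariant (φ : Flow ℝ M) (K : Set M) : Prop :=
  IsCompact K ∧ IsInvariant φ K ∧
    ∃ N : Set M, IsCompact N ∧ N ∈ 𝓝ˢ K ∧ ∀ S : Set M, S ⊆ N → IsInvariant φ S → S ⊆ K

/-- `K` (a compact invariant set) is saddle: it has a neighborhood `U` such that every neighborhood
of `K` contains a point that leaves `U` both in the future and in the past. A compact invariant set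
that is not saddle is non-saddle. -/
def IsSaddle (φ : Flow ℝ M) (K : Set M) : Prop :=
  ∃ U ∈ 𝓝ˢ K, ∀ V ∈ 𝓝ˢ K, ∃ x ∈ V, ¬ posTraj φ x ⊆ U ∧ ¬ negTraj φ x ⊆ U

/-- Isolated non-saddle sets. -/
def IsIsolatedNonSaddle (φ : Flow ℝ M) (K : Set M) : Prop :=
  IsIsolatedInvariant φ K ∧ ¬ IsSaddle φ K

/-- The stable manifold `𝓐(K)`. -/
def stableManifold (φ : Flow ℝ M) (K : Set M) : Set M :=
  {x | (omegaPos φ x).Nonempty ∧ omegaPos φ x ⊆ K}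

/-- The unstable manifold `𝓡(K)`. -/
def unstableManifold (φ : Flow ℝ M) (K : Set M) : Set M :=
  {x | (omegaNeg φ x).Nonempty ∧ omegaNeg φ x ⊆ K}

/-- The region of influence `𝓘(K)`. -/
def influence (φ : Flow ℝ M) (K : Set M) : Set M :=
  stableManifold φ K ∪ unstableManifold φ K

/-- The set of homoclinic points of `K`, that is, `(𝓐(K) ∩ 𝓡(K)) - K`. -/
def homoclinicPoints (φ : Flow ℝ M) (K : Set M) : Set M :=
  (stableManifold φ K ∩ unstableManifold φ K) \ K

/-- (Lyapunov) stability of `K` in positive time. -/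
def IsStable (φ : Flow ℝ M) (K : Set M) : Prop :=
  ∀ U ∈ 𝓝ˢ K, ∃ V ∈ 𝓝ˢ K, ∀ x ∈ V, posTraj φ x ⊆ U

/-- Unstable global attractors: isolated invariant compacta that attract every point of the space
and are not stable. -/
def IsUnstableGlobalAttractor (φ : Flow ℝ M) (K : Set M) : Prop :=
  IsIsolatedInvariant φ K ∧ stableManifold φ K = univ ∧ ¬ IsStable φ K

/-- The two-sided prolongational limit set `J*(x)`. -/
def prolongLimit (φ : Flow ℝ M) (x : M) : Set (M × M) :=
  {p | ∃ (u : ℕ → M) (t s : ℕ → ℝ),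
    Tendsto u atTop (𝓝 x) ∧ Tendsto t atTop atTop ∧ Tendsto s atTop atBot ∧
    Tendsto (fun n => φ (t n) (u n)) atTop (𝓝 p.1) ∧
    Tendsto (fun n => φ (s n) (u n)) atTop (𝓝 p.2)}

/-- The externally dissonant points of `K`. -/
def externallyDissonant (φ : Flow ℝ M) (K : Set M) : Set M :=
  {x | x ∉ influence φ K ∧ (prolongLimit φ x ∩ K ×ˢ K).Nonempty}

/-- The complement `L` of the region of influence of `K`. -/
def uninfluenced (φ : Flow ℝ M) (K : Set M) : Set M := (influence φ K)ᶜ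

/-- The union `L_s` of the saddle components of `L`. -/
def uninfluencedSaddle (φ : Flow ℝ M) (K : Set M) : Set M :=
  ⋃₀ {C | C ∈ componentsOf (uninfluenced φ K) ∧ IsSaddle φ C}

end NonSaddle

open NonSaddle

namespace NonSaddle

universe u

set_option linter.unusedSectionVars false

variable {M : Type u} [TopologicalSpace M] {φ : Flow ℝ M} {K N U G Q Q' W : Set M} {x y : M}

/-! ### Time reversal. -/

section Reverse

/-! Let H be the set of homoclinic points. An orbit that comes close to a non-saddle K stays close
in the future or in the past. Hence the regions 𝓐(K) - K and 𝓡(K) - K are open and L is compact. The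
same dichotomy identifies the externally dissonant points with L ∩ closure H
(`externallyDissonant_eq`).

The tool is the tame piece: a relatively clopen Q ⊆ L missing closure H. Near Q no orbit is
attracted to K both ways, and a uniform bound on travel times makes Q non-saddle
(`IsTamePiece.not_isSaddle`). A component of L missing closure H lies in arbitrarily small tame
pieces, so it is non-saddle; one meeting closure H is saddle, because nearby homoclinic orbits
escape both ways.

Thus L_n is the union of all tame pieces, and it remains to show that it is itself tame. For tame Q,
𝓘(Q) is relatively clopen in 𝓘(K) - K (`IsTamePiece.subset_influence`), a set with finitely many
components. Every nonempty tame piece influences one of them, and disjoint pieces influence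
different ones, so a greatest tame piece exists. The last claim follows because 𝓘(Q) contains no
homoclinic point. -/

theorem mem_omegaPos_iff : y ∈ omegaPos φ x ↔ MapClusterPt y atTop (fun t => φ t x) :=
  mem_omegaLimit_singleton_iff_mapClusterPt ..

theorem reverse_reverse (φ : Flow ℝ M) : φ.reverse.reverse = φ := by
  ext t x
  simp

theorem omegaPos_reverse (φ : Flow ℝ M) (x : M) : omegaPos φ.reverse x = omegaNeg φ x := by
  ext y
  have h : map (fun t : ℝ => φ (-t) x) atTop = map (fun t => φ t x) atBot := by
    rw [← map_neg_atTop, map_map]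
    rfl
  rw [mem_omegaPos_iff, omegaNeg, mem_omegaLimit_singleton_iff_mapClusterPt, MapClusterPt,
    MapClusterPt, ← h]
  rfl

theorem omegaNeg_reverse (φ : Flow ℝ M) (x : M) : omegaNeg φ.reverse x = omegaPos φ x := by
  rw [← omegaPos_reverse, reverse_reverse]

theorem stableManifold_reverse (φ : Flow ℝ M) (K : Set M) :
    stableManifold φ.reverse K = unstableManifold φ K := by
  simp only [stableManifold, unstableManifold, omegaPos_reverse]

theorem unstableManifold_reverse (φ : Flow ℝ M) (K : Set M) :
    unstableManifold φ.reverse K = stableManifold φ K := by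
  simp only [stableManifold, unstableManifold, omegaNeg_reverse]

theorem influence_reverse (φ : Flow ℝ M) (K : Set M) :
    influence φ.reverse K = influence φ K := by
  rw [influence, stableManifold_reverse, unstableManifold_reverse, union_comm, influence]

theorem uninfluenced_reverse (φ : Flow ℝ M) (K : Set M) :
    uninfluenced φ.reverse K = uninfluenced φ K := by
  rw [uninfluenced, influence_reverse, uninfluenced]

theorem homoclinicPoints_reverse (φ : Flow ℝ M) (K : Set M) :
    homoclinicPoints φ.reverse K = homoclinicPoints φ K := by
  rw [homoclinicPoints, stableManifold_reverse, unstableManifold_reverse, inter_comm,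
    homoclinicPoints]

theorem posTraj_reverse (φ : Flow ℝ M) (x : M) : posTraj φ.reverse x = negTraj φ x := by
  ext y
  constructor
  · rintro ⟨t, ht, rfl⟩
    exact ⟨-t, by linarith, rfl⟩
  · rintro ⟨t, ht, rfl⟩
    exact ⟨-t, by linarith, by simp⟩

theorem negTraj_reverse (φ : Flow ℝ M) (x : M) : negTraj φ.reverse x = posTraj φ x := by
  rw [← posTraj_reverse, reverse_reverse]

theorem isInvariant_reverse (h : IsInvariant φ K) : IsInvariant φ.reverse K :=
  fun t => h (-t)

theorem isSaddle_reverse : IsSaddle φ.reverse K ↔ IsSaddle φ K := by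
  simp only [IsSaddle, posTraj_reverse, negTraj_reverse]
  simp only [and_comm]

theorem IsIsolatedInvariant.reverse (h : IsIsolatedInvariant φ K) :
    IsIsolatedInvariant φ.reverse K := by
  obtain ⟨hc, hi, N, hN, hKN, hS⟩ := h
  refine ⟨hc, isInvariant_reverse hi, N, hN, hKN, fun S hSN hSi => hS S hSN ?_⟩
  rw [← reverse_reverse φ]
  exact isInvariant_reverse hSi

theorem IsIsolatedNonSaddle.reverse (h : IsIsolatedNonSaddle φ K) :
    IsIsolatedNonSaddle φ.reverse K :=
  ⟨h.1.reverse, fun hs => h.2 (isSaddle_reverse.1 hs)⟩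

end Reverse

/-! ### Isolating neighborhoods and the topology of the region of influence. -/

section Basic

theorem exists_nhds_of_not_isSaddle (h : ¬ IsSaddle φ K) (hU : U ∈ 𝓝ˢ K) :
    ∃ V ∈ 𝓝ˢ K, ∀ x ∈ V, posTraj φ x ⊆ U ∨ negTraj φ x ⊆ U := by
  simp only [IsSaddle] at h
  push Not at h
  obtain ⟨V, hV, h⟩ := h U hU
  refine ⟨V, hV, fun x hx => ?_⟩
  by_contra hc
  push Not at hc
  exact hc.2 (h x hx hc.1)

theorem isClosed_omegaPos : IsClosed (omegaPos φ x) := isClosed_omegaLimit ..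

theorem isInvariant_omegaPos : IsInvariant φ (omegaPos φ x) :=
  Flow.isInvariant_omegaLimit _ _ _ fun t => tendsto_atTop_add_const_left _ t tendsto_id

theorem omegaPos_subset_of_eventually (hN : IsClosed N) (h : ∀ᶠ t in atTop, φ t x ∈ N) :
    omegaPos φ x ⊆ N := by
  intro y hy
  rw [mem_omegaPos_iff] at hy
  by_contra hyN
  obtain ⟨t, h1, h2⟩ := ((hy.frequently (hN.isOpen_compl.mem_nhds hyN)).and_eventually h).exists
  exact h1 h2

theorem omegaPos_subset (hN : IsClosed N) (hi : IsInvariant φ N) (hx : x ∈ N) :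
    omegaPos φ x ⊆ N :=
  omegaPos_subset_of_eventually hN (Eventually.of_forall fun t => hi t hx)

theorem omegaPos_flow (φ : Flow ℝ M) (s : ℝ) (x : M) : omegaPos φ (φ s x) = omegaPos φ x := by
  have h := Flow.omegaLimit_image_eq atTop φ {x}
    (fun t => tendsto_atTop_add_const_right _ t tendsto_id) s
  rw [image_singleton] at h
  exact h

theorem omegaNeg_flow (φ : Flow ℝ M) (s : ℝ) (x : M) : omegaNeg φ (φ s x) = omegaNeg φ x := by
  have h := omegaPos_flow φ.reverse (-s) x
  rwa [Flow.reverse_apply, neg_neg, omegaPos_reverse, omegaPos_reverse] at h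

theorem isInvariant_stableManifold : IsInvariant φ (stableManifold φ K) := by
  intro t x hx
  rwa [stableManifold, mem_ofPred, omegaPos_flow]

theorem isInvariant_influence : IsInvariant φ (influence φ K) := by
  intro t x hx
  rwa [influence, mem_union, stableManifold, mem_ofPred, unstableManifold, mem_ofPred, omegaPos_flow,
    omegaNeg_flow]

theorem isInvariant_compl (h : IsInvariant φ K) : IsInvariant φ Kᶜ := by
  intro t x hx hx'
  have := h (-t) hx'
  rw [← Flow.map_add, neg_add_cancel, Flow.map_zero_apply] at this
  exact hx this

theorem isInvariant_uninfluenced : IsInvariant φ (uninfluenced φ K) :=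
  isInvariant_compl isInvariant_influence

theorem isPreconnected_range_flow (φ : Flow ℝ M) (x : M) :
    IsPreconnected (range fun t => φ t x) :=
  isPreconnected_range (by fun_prop)

variable [CompactSpace M]

theorem omegaPos_nonempty (φ : Flow ℝ M) (x : M) : (omegaPos φ x).Nonempty :=
  nonempty_omegaLimit _ _ _ (singleton_nonempty x)

theorem eventually_mem_of_omegaPos_subset (hN : N ∈ 𝓝ˢ K) (h : omegaPos φ x ⊆ K) :
    ∀ᶠ t in atTop, φ t x ∈ N := by
  have := eventually_mapsTo_of_isOpen_of_omegaLimit_subset atTop φ {x} isOpen_interior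
    (h.trans (subset_interior_iff_mem_nhdsSet.2 hN))
  filter_upwards [this] with t ht
  exact interior_subset (ht rfl)

variable [T2Space M]

theorem exists_isClosed_mem_nhdsSet_subset (hK : IsClosed K) (hG : G ∈ 𝓝ˢ K) :
    ∃ N ⊆ G, IsClosed N ∧ N ∈ 𝓝ˢ K := by
  obtain ⟨V, hV, hKV, hVG⟩ := normal_exists_closure_subset hK isOpen_interior
    (subset_interior_iff_mem_nhdsSet.2 hG)
  exact ⟨closure V, hVG.trans interior_subset, isClosed_closure,
    mem_of_superset (hV.mem_nhdsSet.2 hKV) subset_closure⟩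

/-- A closed isolating neighborhood, expressed in terms of trajectories. -/
structure IsIsolatingNhd (φ : Flow ℝ M) (K N : Set M) : Prop where
  isClosed : IsClosed N
  mem_nhdsSet : N ∈ 𝓝ˢ K
  subset : ∀ S ⊆ N, IsInvariant φ S → S ⊆ K

theorem IsIsolatedInvariant.exists_isIsolatingNhd (hK : IsIsolatedInvariant φ K)
    (hG : G ∈ 𝓝ˢ K) : ∃ N ⊆ G, IsIsolatingNhd φ K N := by
  obtain ⟨hc, hi, N, hN, hKN, hS⟩ := hK
  obtain ⟨N', hN', h1, h2⟩ := exists_isClosed_mem_nhdsSet_subset hc.isClosed (inter_mem hG hKN)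
  exact ⟨N', hN'.trans inter_subset_left, h1, h2,
    fun S hSN => hS S (hSN.trans (hN'.trans inter_subset_right))⟩

theorem IsIsolatingNhd.mem_stableManifold (hN : IsIsolatingNhd φ K N)
    (h : ∀ᶠ t in atTop, φ t x ∈ N) : x ∈ stableManifold φ K :=
  ⟨omegaPos_nonempty φ x,
    hN.subset _ (omegaPos_subset_of_eventually hN.isClosed h) isInvariant_omegaPos⟩

theorem IsIsolatingNhd.mem_of_forall (hN : IsIsolatingNhd φ K N) (h : ∀ t, φ t x ∈ N) :
    x ∈ K := by
  refine hN.subset (range fun t => φ t x) (range_subset_iff.2 h) ?_ ⟨0, φ.map_zero_apply x⟩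
  rintro t _ ⟨s, rfl⟩
  exact ⟨t + s, φ.map_add t s x⟩

theorem IsIsolatingNhd.reverse (hN : IsIsolatingNhd φ K N) : IsIsolatingNhd φ.reverse K N := by
  refine ⟨hN.isClosed, hN.mem_nhdsSet, fun S hS hi => hN.subset S hS ?_⟩
  rw [← reverse_reverse φ]
  exact isInvariant_reverse hi

variable (hK : IsIsolatedNonSaddle φ K)
include hK

theorem IsIsolatedNonSaddle.isClosed : IsClosed K := hK.1.1.isClosed

theorem IsIsolatedNonSaddle.isInvariant : IsInvariant φ K := hK.1.2.1

theorem IsIsolatedNonSaddle.subset_stableManifold : K ⊆ stableManifold φ K :=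
  fun x hx => ⟨omegaPos_nonempty φ x, omegaPos_subset hK.isClosed hK.isInvariant hx⟩

theorem IsIsolatedNonSaddle.subset_influence : K ⊆ influence φ K :=
  hK.subset_stableManifold.trans subset_union_left

/-- If ω(x) meets K, the orbit enters a small V at some t ≥ 0 and must then stay in N forever,
forward or backward. Backward is impossible, since N was chosen to miss x. -/
theorem IsIsolatedNonSaddle.mem_stableManifold_iff :
    x ∈ stableManifold φ K ↔ (omegaPos φ x ∩ K).Nonempty := by
  constructor
  · rintro ⟨⟨y, hy⟩, h⟩
    exact ⟨y, hy, h hy⟩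
  rintro ⟨y, hy, hyK⟩
  by_cases hxK : x ∈ K
  · exact hK.subset_stableManifold hxK
  obtain ⟨N, hNx, hN⟩ := hK.1.exists_isIsolatingNhd (G := {x}ᶜ)
    (isOpen_compl_singleton.mem_nhdsSet.2 (by simpa using hxK))
  obtain ⟨V, hV, h⟩ := exists_nhds_of_not_isSaddle hK.2 hN.mem_nhdsSet
  rw [mem_omegaPos_iff] at hy
  obtain ⟨t, htV, ht⟩ := ((hy.frequently (mem_nhdsSet_iff_forall.1 hV y hyK)).and_eventually
    (eventually_ge_atTop 0)).exists
  apply hN.mem_stableManifold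
  rcases h _ htV with h | h
  · filter_upwards [eventually_ge_atTop t] with s hs
    refine h ⟨s - t, by linarith, ?_⟩
    rw [← Flow.map_add, sub_add_cancel]
  · refine absurd rfl (hNx (h ⟨-t, by linarith, ?_⟩))
    rw [← Flow.map_add, neg_add_cancel, Flow.map_zero_apply]

theorem IsIsolatedNonSaddle.mem_unstableManifold_iff :
    x ∈ unstableManifold φ K ↔ (omegaNeg φ x ∩ K).Nonempty := by
  rw [← stableManifold_reverse, hK.reverse.mem_stableManifold_iff, omegaPos_reverse]

/-- The time at which x enters V also serves all nearby points, and these start outside U, so only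
the forward alternative is open to them. -/
theorem IsIsolatedNonSaddle.exists_eventually_forall_ge (hx : x ∈ stableManifold φ K)
    (hxK : x ∉ K) (hN : N ∈ 𝓝ˢ K) : ∃ T, ∀ᶠ y in 𝓝 x, ∀ t ≥ T, φ t y ∈ N := by
  have hd : Disjoint (𝓝ˢ K) (𝓝 x) := disjoint_nhdsSet_nhds.2 (by rwa [hK.isClosed.closure_eq])
  obtain ⟨U, hU, O, hO, hUO⟩ := Filter.disjoint_iff.1 hd
  obtain ⟨V, hV, h⟩ := exists_nhds_of_not_isSaddle hK.2 (inter_mem hU hN)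
  obtain ⟨t, htV, ht⟩ := ((eventually_mem_of_omegaPos_subset
    (isOpen_interior.mem_nhdsSet.2 (subset_interior_iff_mem_nhdsSet.2 hV)) hx.2).and
    (eventually_ge_atTop 0)).exists
  refine ⟨t, ?_⟩
  filter_upwards [hO, (φ.continuous_toFun t).continuousAt.preimage_mem_nhds
    (isOpen_interior.mem_nhds htV)] with y hyO hyV s hs
  rcases h _ (interior_subset hyV) with h | h
  · refine (h ⟨s - t, by linarith, ?_⟩).2
    rw [← Flow.map_add, sub_add_cancel]
  · refine absurd hyO (disjoint_left.1 hUO (h ⟨-t, by linarith, ?_⟩).1)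
    rw [← Flow.map_add, neg_add_cancel, Flow.map_zero_apply]

theorem IsIsolatedNonSaddle.exists_forall_ge {F : Set M} (hF : IsCompact F)
    (hFA : F ⊆ stableManifold φ K \ K) (hN : N ∈ 𝓝ˢ K) :
    ∃ T, ∀ y ∈ F, ∀ t ≥ T, φ t y ∈ N := by
  refine hF.induction_on (p := fun F => ∃ T, ∀ y ∈ F, ∀ t ≥ T, φ t y ∈ N) ⟨0, by simp⟩ ?_ ?_ ?_
  · rintro s t hst ⟨T, hT⟩
    exact ⟨T, fun y hy => hT y (hst hy)⟩
  · rintro s t ⟨T, hT⟩ ⟨T', hT'⟩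
    refine ⟨max T T', fun y hy r hr => ?_⟩
    rcases hy with hy | hy
    · exact hT y hy r ((le_max_left _ _).trans hr)
    · exact hT' y hy r ((le_max_right _ _).trans hr)
  · intro x hx
    obtain ⟨T, hT⟩ := hK.exists_eventually_forall_ge (hFA hx).1 (hFA hx).2 hN
    exact ⟨_, mem_nhdsWithin_of_mem_nhds hT, T, fun y hy => hy⟩

theorem IsIsolatedNonSaddle.isOpen_stableManifold_diff : IsOpen (stableManifold φ K \ K) := by
  rw [isOpen_iff_mem_nhds]
  rintro x ⟨hx, hxK⟩
  obtain ⟨N, -, hN⟩ := hK.1.exists_isIsolatingNhd univ_mem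
  obtain ⟨T, hT⟩ := hK.exists_eventually_forall_ge hx hxK hN.mem_nhdsSet
  filter_upwards [hT, hK.isClosed.isOpen_compl.mem_nhds hxK] with y hy hyK
  exact ⟨hN.mem_stableManifold ((eventually_ge_atTop T).mono hy), hyK⟩

theorem IsIsolatedNonSaddle.isOpen_unstableManifold_diff :
    IsOpen (unstableManifold φ K \ K) := by
  rw [← stableManifold_reverse]
  exact hK.reverse.isOpen_stableManifold_diff

theorem IsIsolatedNonSaddle.influence_mem_nhdsSet : influence φ K ∈ 𝓝ˢ K := by
  obtain ⟨N, -, hN⟩ := hK.1.exists_isIsolatingNhd univ_mem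
  obtain ⟨V, hV, h⟩ := exists_nhds_of_not_isSaddle hK.2 hN.mem_nhdsSet
  refine mem_of_superset hV fun x hx => (h x hx).imp (fun h => ?_) fun h => ?_
  · exact hN.mem_stableManifold ((eventually_ge_atTop 0).mono fun t ht => h ⟨t, ht, rfl⟩)
  · rw [← stableManifold_reverse]
    rw [← posTraj_reverse] at h
    exact hN.reverse.mem_stableManifold ((eventually_ge_atTop 0).mono fun t ht => h ⟨t, ht, rfl⟩)

theorem IsIsolatedNonSaddle.isOpen_influence_diff : IsOpen (influence φ K \ K) := by
  rw [influence, union_sdiff_distrib]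
  exact hK.isOpen_stableManifold_diff.union hK.isOpen_unstableManifold_diff

theorem IsIsolatedNonSaddle.isOpen_influence : IsOpen (influence φ K) := by
  rw [isOpen_iff_mem_nhds]
  intro x hx
  by_cases hxK : x ∈ K
  · exact mem_nhdsSet_iff_forall.1 hK.influence_mem_nhdsSet x hxK
  · exact mem_of_superset (hK.isOpen_influence_diff.mem_nhds ⟨hx, hxK⟩) sdiff_subset

theorem IsIsolatedNonSaddle.isClosed_uninfluenced : IsClosed (uninfluenced φ K) :=
  hK.isOpen_influence.isClosed_compl

theorem IsIsolatedNonSaddle.disjoint_uninfluenced : Disjoint K (uninfluenced φ K) :=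
  disjoint_compl_right_iff_subset.2 hK.subset_influence

theorem IsIsolatedNonSaddle.isOpen_homoclinicPoints : IsOpen (homoclinicPoints φ K) := by
  have : homoclinicPoints φ K = (stableManifold φ K \ K) ∩ (unstableManifold φ K \ K) := by
    ext x
    simp only [homoclinicPoints, Set.mem_sdiff, mem_inter_iff]
    tauto
  rw [this]
  exact hK.isOpen_stableManifold_diff.inter hK.isOpen_unstableManifold_diff

/-- Being closed and invariant, ω(x) contains both limit sets of y, hence a point of K. -/
theorem IsIsolatedNonSaddle.mem_stableManifold_of_mem_omegaPos (hy : y ∈ omegaPos φ x)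
    (hyK : y ∈ influence φ K) : x ∈ stableManifold φ K := by
  rw [hK.mem_stableManifold_iff]
  rcases hyK with ⟨⟨z, hz⟩, h⟩ | ⟨⟨z, hz⟩, h⟩
  · exact ⟨z, omegaPos_subset isClosed_omegaPos isInvariant_omegaPos hy hz, h hz⟩
  · refine ⟨z, ?_, h hz⟩
    rw [← omegaPos_reverse] at hz
    exact omegaPos_subset isClosed_omegaPos (isInvariant_reverse isInvariant_omegaPos) hy hz

theorem IsIsolatedNonSaddle.omegaPos_subset_uninfluenced (hx : x ∉ stableManifold φ K) :
    omegaPos φ x ⊆ uninfluenced φ K :=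
  fun _ hy hyK => hx (hK.mem_stableManifold_of_mem_omegaPos hy hyK)

theorem IsIsolatedNonSaddle.omegaNeg_subset_uninfluenced (hx : x ∉ unstableManifold φ K) :
    omegaNeg φ x ⊆ uninfluenced φ K := by
  rw [← omegaPos_reverse, ← uninfluenced_reverse]
  exact hK.reverse.omegaPos_subset_uninfluenced (by rwa [stableManifold_reverse])

end Basic

/-! ### Tame pieces: they are non-saddle, and their influence is relatively clopen. -/

section TamePieces

theorem _root_.IsPreconnected.exists_mem_frontier {s : Set M} (hs : IsPreconnected s)
    (hx : x ∈ s) (hxW : x ∈ W) (hy : y ∈ s) (hyW : y ∉ W) : ∃ z ∈ s, z ∈ frontier W := by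
  by_contra! h
  have hint : ∀ z ∈ s, z ∈ W → z ∈ interior W := fun z hz hzW => by
    by_contra hc
    exact h z hz ⟨subset_closure hzW, hc⟩
  have hext : ∀ z ∈ s, z ∉ W → z ∈ (closure W)ᶜ := fun z hz hzW hc =>
    h z hz ⟨hc, fun hi => hzW (interior_subset hi)⟩
  obtain ⟨z, -, hz, hz'⟩ := hs (interior W) (closure W)ᶜ isOpen_interior
    isClosed_closure.isOpen_compl
    (fun z hz => (em (z ∈ W)).imp (hint z hz) (hext z hz)) ⟨x, hx, hint x hx hxW⟩
    ⟨y, hy, hext y hy hyW⟩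
  exact hz' (subset_closure (interior_subset hz))

theorem exists_mem_Icc_frontier {c : ℝ → M} (hc : Continuous c) {a b : ℝ} {s t : ℝ}
    (hs : s ∈ Icc a b) (ht : t ∈ Icc a b) (hsW : c s ∈ W) (htW : c t ∉ W) :
    ∃ r ∈ Icc a b, c r ∈ frontier W := by
  obtain ⟨_, ⟨r, hr, rfl⟩, h⟩ :=
    (isPreconnected_Icc.image c hc.continuousOn).exists_mem_frontier (mem_image_of_mem c hs) hsW
      (mem_image_of_mem c ht) htW
  exact ⟨r, hr, h⟩

/-- A relatively clopen subset of the complement of the region of influence of `K` that is not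
approached by homoclinic points. -/
structure IsTamePiece (φ : Flow ℝ M) (K Q : Set M) : Prop where
  subset : Q ⊆ uninfluenced φ K
  isClosed : IsClosed Q
  isClosed_diff : IsClosed (uninfluenced φ K \ Q)
  disjoint : Disjoint Q (closure (homoclinicPoints φ K))

theorem IsTamePiece.reverse (hQ : IsTamePiece φ K Q) : IsTamePiece φ.reverse K Q := by
  obtain ⟨h1, h2, h3, h4⟩ := hQ
  constructor
  · rwa [uninfluenced_reverse]
  · exact h2
  · rwa [uninfluenced_reverse]
  · rwa [homoclinicPoints_reverse]

theorem isTamePiece_empty (h : IsClosed (uninfluenced φ K)) : IsTamePiece φ K ∅ :=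
  ⟨empty_subset _, isClosed_empty, by rwa [sdiff_empty], empty_disjoint _⟩

theorem IsTamePiece.union (hQ : IsTamePiece φ K Q) (hQ' : IsTamePiece φ K Q') :
    IsTamePiece φ K (Q ∪ Q') := by
  refine ⟨union_subset hQ.subset hQ'.subset, hQ.isClosed.union hQ'.isClosed, ?_,
    hQ.disjoint.union_left hQ'.disjoint⟩
  rw [← sdiff_inter_sdiff]
  exact hQ.isClosed_diff.inter hQ'.isClosed_diff

theorem IsTamePiece.diff (hQ : IsTamePiece φ K Q) (hQ' : IsTamePiece φ K Q') :
    IsTamePiece φ K (Q \ Q') := by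
  have h1 : Q \ Q' = Q ∩ (uninfluenced φ K \ Q') := by
    ext x
    have := @hQ.subset x
    simp only [Set.mem_sdiff, mem_inter_iff]
    tauto
  have h2 : uninfluenced φ K \ (Q \ Q') = (uninfluenced φ K \ Q) ∪ Q' := by
    ext x
    have := @hQ'.subset x
    simp only [Set.mem_sdiff, mem_union]
    tauto
  refine ⟨sdiff_subset.trans hQ.subset, ?_, ?_, hQ.disjoint.mono_left sdiff_subset⟩
  · rw [h1]
    exact hQ.isClosed.inter hQ'.isClosed_diff
  · rw [h2]
    exact hQ.isClosed_diff.union hQ'.isClosed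

theorem isInvariant_of_isClosed_of_isClosed_diff (hQ : Q ⊆ uninfluenced φ K)
    (h1 : IsClosed Q) (h2 : IsClosed (uninfluenced φ K \ Q)) : IsInvariant φ Q := by
  intro t x hx
  have hsub : (range fun t => φ t x) ⊆ Q ∪ uninfluenced φ K \ Q := by
    rintro _ ⟨s, rfl⟩
    have := isInvariant_uninfluenced s (hQ hx)
    exact (em _).imp id fun h => ⟨this, h⟩
  rcases isPreconnected_iff_subset_of_disjoint_closed.1 (isPreconnected_range_flow φ x) Q
    (uninfluenced φ K \ Q) h1 h2 hsub (by simp) with h | h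
  · exact h ⟨t, rfl⟩
  · exact absurd hx (h ⟨0, φ.map_zero_apply x⟩).2

variable [CompactSpace M] [T2Space M]

section

variable (hK : IsIsolatedNonSaddle φ K)
include hK

/-- An invariant set inside a closed neighborhood that misses K and L - Q has no limit points in K,
so it lies in L, hence in Q. -/
theorem isIsolatedInvariant_of_isClosed_of_isClosed_diff (hQ : Q ⊆ uninfluenced φ K)
    (h1 : IsClosed Q) (h2 : IsClosed (uninfluenced φ K \ Q)) : IsIsolatedInvariant φ Q := by
  refine ⟨h1.isCompact, isInvariant_of_isClosed_of_isClosed_diff hQ h1 h2, ?_⟩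
  obtain ⟨W, hWG, hWc, hW⟩ := exists_isClosed_mem_nhdsSet_subset h1
    (G := (K ∪ (uninfluenced φ K \ Q))ᶜ) ((hK.isClosed.union h2).isOpen_compl.mem_nhdsSet.2
    fun x hx => by
      rintro (hx' | hx')
      · exact disjoint_left.1 hK.disjoint_uninfluenced hx' (hQ hx)
      · exact hx'.2 hx)
  refine ⟨W, hWc.isCompact, hW, fun S hSW hS x hx => ?_⟩
  have hxL : x ∈ uninfluenced φ K := by
    rintro (⟨⟨y, hy⟩, h⟩ | ⟨⟨y, hy⟩, h⟩)
    · exact hWG (omegaPos_subset_of_eventually hWc (Eventually.of_forall fun t => hSW (hS t hx)) hy)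
        (Or.inl (h hy))
    · refine hWG ?_ (Or.inl (h hy))
      rw [← omegaPos_reverse] at hy
      exact omegaPos_subset_of_eventually hWc
        (Eventually.of_forall fun t => hSW (isInvariant_reverse hS t hx)) hy
  by_contra hxQ
  exact hWG (hSW hx) (Or.inr ⟨hxL, hxQ⟩)

theorem IsIsolatedNonSaddle.isIsolatedInvariant_uninfluenced :
    IsIsolatedInvariant φ (uninfluenced φ K) :=
  isIsolatedInvariant_of_isClosed_of_isClosed_diff hK Subset.rfl hK.isClosed_uninfluenced
    (by simp)

end

/-- A closed neighborhood of a tame piece `Q`, small enough to see only `Q`. -/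
structure IsTameNhd (φ : Flow ℝ M) (K Q W : Set M) : Prop where
  isClosed : IsClosed W
  mem_nhdsSet : W ∈ 𝓝ˢ Q
  disjoint : Disjoint W K
  inter_subset : W ∩ uninfluenced φ K ⊆ Q
  disjoint_homoclinic : Disjoint W (closure (homoclinicPoints φ K))

theorem IsTameNhd.reverse (hW : IsTameNhd φ K Q W) : IsTameNhd φ.reverse K Q W := by
  obtain ⟨h1, h2, h3, h4, h5⟩ := hW
  refine ⟨h1, h2, h3, ?_, ?_⟩
  · rwa [uninfluenced_reverse]
  · rwa [homoclinicPoints_reverse]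

section

variable (hK : IsIsolatedNonSaddle φ K) (hQ : IsTamePiece φ K Q)
include hK hQ

theorem IsTamePiece.isInvariant : IsInvariant φ Q :=
  isInvariant_of_isClosed_of_isClosed_diff hQ.subset hQ.isClosed hQ.isClosed_diff

theorem IsTamePiece.disjoint_base : Disjoint Q K :=
  (hK.disjoint_uninfluenced.mono_right hQ.subset).symm

theorem IsTamePiece.exists_isTameNhd (hG : G ∈ 𝓝ˢ Q) : ∃ W ⊆ G, IsTameNhd φ K Q W := by
  have h1 := hK.isClosed.isOpen_compl.mem_nhdsSet.2
    (subset_compl_iff_disjoint_right.2 (hQ.disjoint_base hK))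
  have h2 := hQ.isClosed_diff.isOpen_compl.mem_nhdsSet.2
    (subset_compl_iff_disjoint_right.2 disjoint_sdiff_right)
  have h3 := (isClosed_closure (s := homoclinicPoints φ K)).isOpen_compl.mem_nhdsSet.2
    (subset_compl_iff_disjoint_right.2 hQ.disjoint)
  obtain ⟨W, hWG, hWc, hW⟩ := exists_isClosed_mem_nhdsSet_subset hQ.isClosed
    (inter_mem hG (inter_mem h1 (inter_mem h2 h3)))
  refine ⟨W, fun x hx => (hWG hx).1, hWc, hW,
    subset_compl_iff_disjoint_right.1 fun x hx => (hWG hx).2.1, fun x hx => ?_,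
    subset_compl_iff_disjoint_right.1 fun x hx => (hWG hx).2.2.2⟩
  by_contra hxQ
  exact (hWG hx.1).2.2.1 ⟨hx.2, hxQ⟩

variable (hW : IsTameNhd φ K Q W)
include hW

theorem IsTameNhd.frontier_inter_subset :
    frontier W ∩ stableManifold φ K ⊆ stableManifold φ K \ K :=
  fun _ hx => ⟨hx.2, Set.disjoint_left.1 hW.disjoint (hW.isClosed.frontier_subset hx.1)⟩

/-- The frontier of W avoids L, K and the homoclinic points, so on it 𝓐(K) is the complement of the
open set 𝓡(K) - K. -/
theorem IsTameNhd.isCompact_frontier_inter : IsCompact (frontier W ∩ stableManifold φ K) := by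
  have : frontier W ∩ stableManifold φ K = frontier W ∩ (unstableManifold φ K \ K)ᶜ := by
    ext x
    constructor
    · rintro ⟨h1, h2⟩
      exact ⟨h1, fun h3 => Set.disjoint_left.1 hW.disjoint_homoclinic
        (hW.isClosed.frontier_subset h1) (subset_closure ⟨⟨h2, h3.1⟩, h3.2⟩)⟩
    · rintro ⟨h1, h2⟩
      refine ⟨h1, ?_⟩
      have hxW := hW.isClosed.frontier_subset h1
      have hxI : x ∈ influence φ K := by
        by_contra hxL
        exact h1.2 (subset_interior_iff_mem_nhdsSet.2 hW.mem_nhdsSet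
          (hW.inter_subset ⟨hxW, hxL⟩))
      exact hxI.resolve_right fun h => h2 ⟨h, Set.disjoint_left.1 hW.disjoint hxW⟩
  rw [this]
  exact (isClosed_frontier.inter hK.isOpen_unstableManifold_diff.isClosed_compl).isCompact

/-- A backward exit from W would put x on the forward orbit of a point of the compact set F =
frontier W ∩ 𝓐(K). After time T such orbits are outside W; up to time T they sweep out a compact set
disjoint from Q, which V avoids. -/
theorem IsTameNhd.exists_nhds_forall_le :
    ∃ V ∈ 𝓝ˢ Q, ∀ x ∈ V, x ∈ stableManifold φ K → ∀ t ≤ 0, φ t x ∈ W := by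
  have hF := hW.isCompact_frontier_inter hK hQ
  obtain ⟨T, hT⟩ := hK.exists_forall_ge hF (hW.frontier_inter_subset hK hQ)
    (hW.isClosed.isOpen_compl.mem_nhdsSet.2
      (subset_compl_iff_disjoint_left.2 hW.disjoint))
  set F := frontier W ∩ stableManifold φ K
  have hG : IsCompact ((fun p : ℝ × M => φ p.1 p.2) '' Icc 0 T ×ˢ F) :=
    (isCompact_Icc.prod hF).image (by fun_prop)
  refine ⟨W ∩ ((fun p : ℝ × M => φ p.1 p.2) '' Icc 0 T ×ˢ F)ᶜ, inter_mem hW.mem_nhdsSet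
    (hG.isClosed.isOpen_compl.mem_nhdsSet.2 ?_), ?_⟩
  · rintro x hx ⟨⟨t, y⟩, ⟨-, hy⟩, rfl⟩
    have := hQ.isInvariant hK (-t) hx
    simp only [← Flow.map_add, neg_add_cancel, Flow.map_zero_apply] at this
    exact hQ.subset this (Or.inl hy.2)
  · rintro x ⟨hxW, hxG⟩ hxA t ht
    by_contra htW
    obtain ⟨r, hr, hrF⟩ := exists_mem_Icc_frontier (c := fun t => φ t x) (by fun_prop)
      (right_mem_Icc.2 ht) (left_mem_Icc.2 ht) (by simpa using hxW) htW
    have hrF' : φ r x ∈ F := ⟨hrF, isInvariant_stableManifold r hxA⟩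
    have hx : φ (-r) (φ r x) = x := by
      rw [← Flow.map_add, neg_add_cancel, Flow.map_zero_apply]
    rcases le_or_gt T (-r) with h | h
    · exact hT _ hrF' _ h (by rwa [hx])
    · exact hxG ⟨(-r, φ r x), ⟨⟨by linarith [hr.2], h.le⟩, hrF'⟩, hx⟩

omit hW in
theorem IsTamePiece.not_isSaddle : ¬ IsSaddle φ Q := by
  rintro ⟨U, hU, h⟩
  obtain ⟨W, hWU, hW⟩ := hQ.exists_isTameNhd hK hU
  obtain ⟨V, hV, h1⟩ := hW.exists_nhds_forall_le hK hQ
  obtain ⟨V', hV', h2⟩ := hW.reverse.exists_nhds_forall_le hK.reverse hQ.reverse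
  obtain ⟨x, ⟨hxV, hxV', hxW⟩, hp, hn⟩ := h _ (inter_mem hV (inter_mem hV' hW.mem_nhdsSet))
  by_cases hxI : x ∈ influence φ K
  · rcases hxI with hx | hx
    · refine hn ?_
      rintro _ ⟨t, ht, rfl⟩
      exact hWU (h1 x hxV hx t ht)
    · refine hp ?_
      rintro _ ⟨t, ht, rfl⟩
      rw [← stableManifold_reverse] at hx
      have := h2 x hxV' hx (-t) (by linarith)
      rw [Flow.reverse_apply, neg_neg] at this
      exact hWU this
  · refine hp ?_
    rintro _ ⟨t, ht, rfl⟩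
    exact hWU (subset_of_mem_nhdsSet hW.mem_nhdsSet
      (hQ.isInvariant hK t (hW.inter_subset ⟨hxW, hxI⟩)))

omit hW in
theorem IsTamePiece.isIsolatedNonSaddle : IsIsolatedNonSaddle φ Q :=
  ⟨isIsolatedInvariant_of_isClosed_of_isClosed_diff hK hQ.subset hQ.isClosed hQ.isClosed_diff,
    hQ.not_isSaddle hK⟩

omit hW in
theorem IsTamePiece.disjoint_stableManifold :
    Disjoint (stableManifold φ Q) (stableManifold φ K) := by
  rw [Set.disjoint_left]
  rintro x ⟨⟨y, hy⟩, h⟩ ⟨-, h'⟩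
  exact Set.disjoint_left.1 (hQ.disjoint_base hK) (h hy) (h' hy)

omit hW in
theorem IsTamePiece.disjoint_unstableManifold :
    Disjoint (unstableManifold φ Q) (unstableManifold φ K) := by
  rw [← stableManifold_reverse, ← stableManifold_reverse]
  exact hQ.reverse.disjoint_stableManifold hK.reverse

omit hW in
theorem IsTamePiece.disjoint_influence_homoclinicPoints :
    Disjoint (influence φ Q) (homoclinicPoints φ K) := by
  rw [Set.disjoint_left]
  rintro x (hx | hx) h
  · exact Set.disjoint_left.1 (hQ.disjoint_stableManifold hK) hx h.1.1
  · exact Set.disjoint_left.1 (hQ.disjoint_unstableManifold hK) hx h.1.2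

omit hW in
-- A nearby z in 𝓡(Q) would have to leave W across its frontier long before time r, hence be in N by
-- time r. But y, and so z, is outside N at that time.
theorem IsTamePiece.eventually_notMem_influence_of_mem_stableManifold
    (hyA : y ∈ stableManifold φ K) (hyK : y ∉ K) (hyR : y ∉ unstableManifold φ K)
    (hyQ : y ∉ unstableManifold φ Q) : ∀ᶠ z in 𝓝 y, z ∉ influence φ Q := by
  obtain ⟨W, -, hW⟩ := hQ.exists_isTameNhd hK univ_mem
  obtain ⟨N, hNW, hN⟩ := hK.1.exists_isIsolatingNhd (hW.isClosed.isOpen_compl.mem_nhdsSet.2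
    (subset_compl_iff_disjoint_left.2 hW.disjoint))
  obtain ⟨T, hT⟩ := hK.exists_forall_ge (hW.isCompact_frontier_inter hK hQ)
    (hW.frontier_inter_subset hK hQ) hN.mem_nhdsSet
  obtain ⟨r, hr⟩ : ∃ r, φ r y ∉ N := by
    by_contra! h
    exact hyK (hN.mem_of_forall h)
  have hyW : omegaNeg φ y ⊆ Wᶜ := fun z hz hzW =>
    hyQ (((hQ.isIsolatedNonSaddle hK).mem_unstableManifold_iff).2
      ⟨z, hz, hW.inter_subset ⟨hzW, hK.omegaNeg_subset_uninfluenced hyR hz⟩⟩)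
  rw [← omegaPos_reverse] at hyW
  -- The bound s ≥ T - r ensures that any frontier crossing before time -s precedes r by at least T.
  obtain ⟨s, hsW, hs⟩ := ((eventually_mem_of_omegaPos_subset
    (hW.isClosed.isOpen_compl.mem_nhdsSet.2 hyW) Subset.rfl).and
    (eventually_ge_atTop (T - r))).exists
  rw [Flow.reverse_apply] at hsW
  filter_upwards [hK.isOpen_stableManifold_diff.mem_nhds ⟨hyA, hyK⟩,
    (φ.continuous_toFun (-s)).continuousAt.preimage_mem_nhds
      (hW.isClosed.isOpen_compl.mem_nhds hsW),
    (φ.continuous_toFun r).continuousAt.preimage_mem_nhds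
      (hN.isClosed.isOpen_compl.mem_nhds hr)] with z hzA hzs hzr
  rintro (hz | hz)
  · exact Set.disjoint_left.1 (hQ.disjoint_stableManifold hK) hz hzA.1
  · rw [← stableManifold_reverse] at hz
    obtain ⟨q, hqW, hq⟩ := ((eventually_mem_of_omegaPos_subset hW.mem_nhdsSet hz.2).and
      (eventually_ge_atTop s)).exists
    rw [Flow.reverse_apply] at hqW
    have hqs : -q ≤ -s := by linarith
    obtain ⟨t, ht, htW⟩ := exists_mem_Icc_frontier (c := fun t => φ t z) (by fun_prop)
      (left_mem_Icc.2 hqs) (right_mem_Icc.2 hqs) hqW hzs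
    refine hzr ?_
    have := hT _ ⟨htW, isInvariant_stableManifold t hzA.1⟩ (r - t) (by linarith [ht.2])
    rwa [← Flow.map_add, sub_add_cancel] at this

omit hW in
theorem IsTamePiece.eventually_notMem_influence (hy : y ∈ influence φ K \ K)
    (hyQ : y ∉ influence φ Q) : ∀ᶠ z in 𝓝 y, z ∉ influence φ Q := by
  by_cases hyH : y ∈ homoclinicPoints φ K
  · filter_upwards [hK.isOpen_homoclinicPoints.mem_nhds hyH] with z hz hzQ
    exact Set.disjoint_left.1 (hQ.disjoint_influence_homoclinicPoints hK) hzQ hz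
  rcases hy.1 with hyA | hyR
  · exact hQ.eventually_notMem_influence_of_mem_stableManifold hK hyA hy.2
      (fun h => hyH ⟨⟨hyA, h⟩, hy.2⟩) fun h => hyQ (Or.inr h)
  · rw [← influence_reverse]
    apply hQ.reverse.eventually_notMem_influence_of_mem_stableManifold hK.reverse _ hy.2
    · rw [unstableManifold_reverse]
      exact fun h => hyH ⟨⟨h, hyR⟩, hy.2⟩
    · rw [unstableManifold_reverse]
      exact fun h => hyQ (Or.inl h)
    · rwa [stableManifold_reverse]

omit hW in
theorem IsTamePiece.subset_influence {D : Set M} (hD : IsPreconnected D)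
    (hDK : D ⊆ influence φ K \ K) (hDQ : (D ∩ influence φ Q).Nonempty) :
    D ⊆ influence φ Q := by
  refine hD.subset_of_closure_inter_subset (hQ.isIsolatedNonSaddle hK).isOpen_influence hDQ ?_
  rintro y ⟨hy, hyD⟩
  by_contra hyQ
  obtain ⟨z, hz, hz'⟩ := mem_closure_iff_nhds.1 hy _
    (hQ.eventually_notMem_influence hK (hDK hyD) hyQ)
  exact hz hz'

end

end TamePieces

/-! ### Components of compact sets and local connectedness of ANRs. -/

theorem exists_clopen_in_subset_of_connectedComponentIn_subset {L : Set M} [CompactSpace M]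
    [T2Space M] (hL : IsClosed L) (hx : x ∈ L) (hG : IsOpen G)
    (h : connectedComponentIn L x ⊆ G) :
    ∃ Q ⊆ L, x ∈ Q ∧ Q ⊆ G ∧ IsClosed Q ∧ IsClosed (L \ Q) := by
  have : CompactSpace L := isCompact_iff_compactSpace.1 hL.isCompact
  have hc := connectedComponent_eq_iInter_isClopen (⟨x, hx⟩ : L)
  rw [connectedComponentIn_eq_image hx, image_subset_iff, hc] at h
  have : Nonempty {s : Set L // IsClopen s ∧ (⟨x, hx⟩ : L) ∈ s} :=
    ⟨⟨univ, isClopen_univ, mem_univ _⟩⟩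
  obtain ⟨⟨s, hs, hxs⟩, hsG⟩ := exists_subset_nhds_of_isCompact
    (V := fun s : {s : Set L // IsClopen s ∧ (⟨x, hx⟩ : L) ∈ s} => (s : Set L))
    (fun s t => ⟨⟨s ∩ t, s.2.1.inter t.2.1, s.2.2, t.2.2⟩, inter_subset_left, inter_subset_right⟩)
    (fun s => s.2.1.1.isCompact) (U := Subtype.val ⁻¹' G)
    fun y hy => (hG.preimage continuous_subtype_val).mem_nhds (h hy)
  have hemb := hL.isClosedEmbedding_subtypeVal
  refine ⟨Subtype.val '' s, Subtype.coe_image_subset _ _, ⟨_, hxs, rfl⟩, image_subset_iff.2 hsG,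
    hemb.isClosedMap _ hs.1, ?_⟩
  have hd : L \ Subtype.val '' s = Subtype.val '' sᶜ := by
    ext y
    constructor
    · rintro ⟨hy, hys⟩
      exact ⟨⟨y, hy⟩, fun h => hys ⟨_, h, rfl⟩, rfl⟩
    · rintro ⟨y, hy, rfl⟩
      refine ⟨y.2, ?_⟩
      rintro ⟨z, hz, hzy⟩
      exact hy (Subtype.ext hzy ▸ hz)
  rw [hd]
  exact hemb.isClosedMap _ hs.2.isClosed_compl

theorem isClosed_connectedComponentIn {L : Set M} (hL : IsClosed L) :
    IsClosed (connectedComponentIn L x) := by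
  by_cases hx : x ∈ L
  · rw [connectedComponentIn_eq_image hx]
    exact hL.isClosedEmbedding_subtypeVal.isClosedMap _ isClosed_connectedComponent
  · rw [connectedComponentIn_eq_empty hx]
    exact isClosed_empty

/-- A compact metrizable absolute neighborhood retract is locally connected. -/
theorem IsANR.locallyConnectedSpace [CompactSpace M] (hM : IsANR M) : LocallyConnectedSpace M := by
  obtain ⟨hmet, hM⟩ := hM
  let := TopologicalSpace.metrizableSpaceMetric M
  -- Kuratowski embedding into a normed space: balls there are convex, and the retraction carries
  -- small ones to connected neighborhoods in M.
  let h : M → C(M, ℝ) := fun x => ⟨fun y => dist x y, by fun_prop⟩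
  have hiso : Isometry h := by
    refine Isometry.of_dist_eq fun x y => le_antisymm ?_ ?_
    · rw [ContinuousMap.dist_le dist_nonneg]
      intro z
      rw [Real.dist_eq]
      exact abs_dist_sub_le x y z
    · have := ContinuousMap.dist_apply_le_dist (f := h x) (g := h y) y
      simpa [h, Real.dist_eq] using this
  obtain ⟨U, hU, r, hr, hrU, hrh⟩ := hM C(M, ℝ) h hiso.isClosedEmbedding
  rw [locallyConnectedSpace_iff_connected_subsets]
  intro x O hO
  have hxU : U ∈ 𝓝 (h x) := mem_nhdsSet_iff_forall.1 hU _ ⟨x, rfl⟩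
  have hcont : Tendsto r (𝓝 (h x)) (𝓝 (h x)) := by
    simpa only [ContinuousAt, hrh _ ⟨x, rfl⟩] using hr.continuousAt hxU
  rw [hiso.isEmbedding.nhds_eq_comap] at hO
  obtain ⟨O', hO', hO'O⟩ := hO
  obtain ⟨ε, hε, hB⟩ := Metric.mem_nhds_iff.1 (inter_mem hxU (hcont hO'))
  have hsub : r '' Metric.ball (h x) ε ⊆ range h := by
    rintro _ ⟨z, hz, rfl⟩
    exact hrU (hB hz).1
  refine ⟨h ⁻¹' (r '' Metric.ball (h x) ε), ?_, ?_, ?_⟩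
  · filter_upwards [hiso.continuous.continuousAt.preimage_mem_nhds
      (Metric.ball_mem_nhds (h x) hε)] with y hy
    exact ⟨h y, hy, hrh _ ⟨y, rfl⟩⟩
  · rw [← hiso.isEmbedding.isInducing.isPreconnected_image, image_preimage_eq_of_subset hsub]
    exact (convex_ball (h x) ε).isPreconnected.image r (hr.mono fun z hz => (hB hz).1)
  · rintro y ⟨z, hz, hzy⟩
    refine hO'O ?_
    rw [mem_preimage, ← hzy]
    exact (hB hz).2

/-! ### Dissonant points and saddle components. -/

section Dissonant

variable [CompactSpace M] [T2Space M] (hK : IsIsolatedNonSaddle φ K)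
include hK

theorem IsIsolatedNonSaddle.exists_nhds_mem_stableManifold (hx : x ∉ K) :
    ∃ O ∈ 𝓝 x, ∃ V ∈ 𝓝ˢ K, ∀ y ∈ O, y ∉ K ∧
      ((∃ t ≥ 0, φ t y ∈ V) → y ∈ stableManifold φ K) := by
  obtain ⟨U, hU, O, hO, hUO⟩ := Filter.disjoint_iff.1
    (disjoint_nhdsSet_nhds.2 (by rwa [hK.isClosed.closure_eq]) : Disjoint (𝓝ˢ K) (𝓝 x))
  obtain ⟨N, hNU, hN⟩ := hK.1.exists_isIsolatingNhd hU
  obtain ⟨V, hV, h⟩ := exists_nhds_of_not_isSaddle hK.2 hN.mem_nhdsSet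
  refine ⟨O, hO, V, hV, fun y hy => ⟨fun hyK =>
    disjoint_left.1 hUO (subset_of_mem_nhdsSet hU hyK) hy, ?_⟩⟩
  rintro ⟨t, ht, htV⟩
  apply hN.mem_stableManifold
  rcases h _ htV with h | h
  · filter_upwards [eventually_ge_atTop t] with s hs
    refine h ⟨s - t, by linarith, ?_⟩
    rw [← Flow.map_add, sub_add_cancel]
  · refine absurd hy (disjoint_left.1 hUO (hNU (h ⟨-t, by linarith, ?_⟩)))
    rw [← Flow.map_add, neg_add_cancel, Flow.map_zero_apply]

theorem IsIsolatedNonSaddle.externallyDissonant_eq [TopologicalSpace.MetrizableSpace M] :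
    externallyDissonant φ K = uninfluenced φ K ∩ closure (homoclinicPoints φ K) := by
  let := TopologicalSpace.metrizableSpaceMetric M
  ext x
  refine and_congr_right fun hxI => ?_
  constructor
  · rintro ⟨⟨p, q⟩, ⟨u, t, s, hu, ht, hs, hp, hq⟩, hpK, hqK⟩
    have hxK : x ∉ K := fun h => hxI (hK.subset_influence h)
    obtain ⟨O, hO, V, hV, h⟩ := hK.exists_nhds_mem_stableManifold hxK
    obtain ⟨O', hO', V', hV', h'⟩ := hK.reverse.exists_nhds_mem_stableManifold hxK
    refine mem_closure_of_frequently_of_tendsto (Eventually.frequently ?_) hu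
    filter_upwards [hu hO, hu hO', hp (mem_nhdsSet_iff_forall.1 hV p hpK),
      hq (mem_nhdsSet_iff_forall.1 hV' q hqK), ht.eventually_ge_atTop 0,
      hs.eventually_le_atBot 0] with n h1 h2 h3 h4 h5 h6
    have hR := (h' _ h2).2 ⟨-s n, by linarith, by simpa using h4⟩
    rw [stableManifold_reverse] at hR
    exact ⟨⟨(h _ h1).2 ⟨_, h5, h3⟩, hR⟩, (h _ h1).1⟩
  · intro hx
    obtain ⟨u, huH, hu⟩ := mem_closure_iff_seq_limit.1 hx
    -- Used for φ and its reverse: times beyond n at which the orbit is within 1/(n+1) of K.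
    -- Compactness of K × K then gives the two limits along one subsequence.
    have key : ∀ (ψ : Flow ℝ M) (n : ℕ), u n ∈ stableManifold ψ K →
        ∃ t : ℝ, ∃ k ∈ K, (n : ℝ) ≤ t ∧ dist (ψ t (u n)) k < 1 / ((n : ℝ) + 1) := by
      rintro ψ n ⟨⟨k, hk⟩, h⟩
      obtain ⟨t, h1, h2⟩ := ((mem_omegaPos_iff.1 hk).frequently (Metric.ball_mem_nhds k
        (Nat.one_div_pos_of_nat (n := n)))).and_eventually (eventually_ge_atTop (n : ℝ)) |>.exists
      exact ⟨t, k, h hk, h2, h1⟩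
    choose t k hkK ht htk using fun n => key φ n (huH n).1.1
    choose s l hlK hs hsl using fun n => key φ.reverse n
      (by rw [stableManifold_reverse]; exact (huH n).1.2)
    obtain ⟨⟨p, q⟩, hpq, f, hf, hlim⟩ := (hK.1.1.prod hK.1.1).tendsto_subseq
      (x := fun n => (k n, l n)) fun n => ⟨hkK n, hlK n⟩
    have hf' := hf.tendsto_atTop
    have hz := (tendsto_one_div_add_atTop_nhds_zero_nat (𝕜 := ℝ)).comp hf'
    have hcast := tendsto_natCast_atTop_atTop (R := ℝ)
    refine ⟨(p, q), ⟨u ∘ f, t ∘ f, fun n => -s (f n), hu.comp hf',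
      (tendsto_atTop_mono ht hcast).comp hf',
      tendsto_neg_atTop_atBot.comp ((tendsto_atTop_mono hs hcast).comp hf'), ?_, ?_⟩, hpq⟩
    · refine (tendsto_iff_of_dist ?_).1 ((continuous_fst.tendsto (p, q)).comp hlim)
      refine squeeze_zero (fun _ => dist_nonneg) (fun n => ?_) hz
      rw [dist_comm]
      exact (htk (f n)).le
    · refine (tendsto_iff_of_dist ?_).1 ((continuous_snd.tendsto (p, q)).comp hlim)
      refine squeeze_zero (fun _ => dist_nonneg) (fun n => ?_) hz
      rw [dist_comm]
      exact (hsl (f n)).le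

/-- Homoclinic points arbitrarily near C have both limit sets in K, so they leave a closed W
disjoint from K in both time directions. -/
theorem IsIsolatedNonSaddle.isSaddle_of_inter_closure {C : Set M} (hC : IsClosed C)
    (hCL : C ⊆ uninfluenced φ K) (h : (C ∩ closure (homoclinicPoints φ K)).Nonempty) :
    IsSaddle φ C := by
  obtain ⟨W, hWK, hWc, hW⟩ := exists_isClosed_mem_nhdsSet_subset hC
    (hK.isClosed.isOpen_compl.mem_nhdsSet.2
      (subset_compl_iff_disjoint_left.2 (hK.disjoint_uninfluenced.mono_right hCL)))
  obtain ⟨x, hxC, hx⟩ := h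
  refine ⟨W, hW, fun V hV => ?_⟩
  obtain ⟨y, hyV, hy⟩ := mem_closure_iff_nhds.1 hx V (mem_nhdsSet_iff_forall.1 hV x hxC)
  have key : ∀ ψ : Flow ℝ M, y ∈ stableManifold ψ K → ¬ posTraj ψ y ⊆ W := by
    rintro ψ ⟨⟨z, hz⟩, h⟩ hsub
    exact hWK (omegaPos_subset_of_eventually hWc
      ((eventually_ge_atTop 0).mono fun t ht => hsub ⟨t, ht, rfl⟩) hz) (h hz)
  refine ⟨y, hyV, key φ hy.1.1, ?_⟩
  rw [← posTraj_reverse]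
  exact key _ (by rw [stableManifold_reverse]; exact hy.1.2)

theorem IsIsolatedNonSaddle.exists_isTamePiece (hx : x ∈ uninfluenced φ K) (hG : IsOpen G)
    (hCG : connectedComponentIn (uninfluenced φ K) x ⊆ G)
    (hC : Disjoint (connectedComponentIn (uninfluenced φ K) x)
      (closure (homoclinicPoints φ K))) :
    ∃ Q, IsTamePiece φ K Q ∧ x ∈ Q ∧ Q ⊆ G := by
  obtain ⟨Q, hQ, hxQ, hQG, h1, h2⟩ := exists_clopen_in_subset_of_connectedComponentIn_subset
    hK.isClosed_uninfluenced hx (hG.inter isClosed_closure.isOpen_compl)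
    (subset_inter hCG (subset_compl_iff_disjoint_right.2 hC))
  exact ⟨Q, ⟨hQ, h1, h2, subset_compl_iff_disjoint_right.1 fun y hy => (hQG hy).2⟩, hxQ,
    fun y hy => (hQG hy).1⟩

omit [CompactSpace M] [T2Space M] hK in
theorem IsTamePiece.connectedComponentIn_subset (hQ : IsTamePiece φ K Q) (hx : x ∈ Q) :
    connectedComponentIn (uninfluenced φ K) x ⊆ Q := by
  have hx' := mem_connectedComponentIn (hQ.subset hx)
  have hsub := _root_.connectedComponentIn_subset (uninfluenced φ K) x
  rcases isPreconnected_iff_subset_of_disjoint_closed.1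
    (isPreconnected_connectedComponentIn (F := uninfluenced φ K) (x := x)) Q
    (uninfluenced φ K \ Q) hQ.isClosed hQ.isClosed_diff
    (fun y hy => (em _).imp id fun h => ⟨hsub hy, h⟩) (by simp) with h | h
  · exact h
  · exact absurd hx (h hx').2

theorem IsIsolatedNonSaddle.isSaddle_connectedComponentIn_iff (hx : x ∈ uninfluenced φ K) :
    IsSaddle φ (connectedComponentIn (uninfluenced φ K) x) ↔
      (connectedComponentIn (uninfluenced φ K) x ∩ closure (homoclinicPoints φ K)).Nonempty := by
  refine ⟨fun hs => ?_, hK.isSaddle_of_inter_closure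
    (isClosed_connectedComponentIn hK.isClosed_uninfluenced) (connectedComponentIn_subset _ _)⟩
  by_contra hC
  rw [not_nonempty_iff_eq_empty, ← disjoint_iff_inter_eq_empty] at hC
  obtain ⟨U, hU, h⟩ := hs
  obtain ⟨Q, hQ, hxQ, hQU⟩ := hK.exists_isTamePiece hx isOpen_interior
    (subset_interior_iff_mem_nhdsSet.2 hU) hC
  -- Since Q contains the component, neighborhoods of Q are neighborhoods of the component, so U
  -- would witness that Q is saddle.
  exact hQ.not_isSaddle hK ⟨U, subset_interior_iff_mem_nhdsSet.1 hQU, fun V hV =>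
    h V (nhdsSet_mono (hQ.connectedComponentIn_subset hxQ) hV)⟩

theorem IsIsolatedNonSaddle.mem_uninfluencedSaddle_iff (hx : x ∈ uninfluenced φ K) :
    x ∈ uninfluencedSaddle φ K ↔
      (connectedComponentIn (uninfluenced φ K) x ∩ closure (homoclinicPoints φ K)).Nonempty := by
  rw [← hK.isSaddle_connectedComponentIn_iff hx]
  constructor
  · rintro ⟨_, ⟨⟨z, hz, rfl⟩, hs⟩, hxz⟩
    rwa [← connectedComponentIn_eq hxz]
  · exact fun hs => ⟨_, ⟨⟨x, hx, rfl⟩, hs⟩, mem_connectedComponentIn hx⟩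

theorem IsIsolatedNonSaddle.notMem_uninfluencedSaddle_iff (hx : x ∈ uninfluenced φ K) :
    x ∉ uninfluencedSaddle φ K ↔ ∃ Q, IsTamePiece φ K Q ∧ x ∈ Q := by
  rw [hK.mem_uninfluencedSaddle_iff hx, not_nonempty_iff_eq_empty, ← disjoint_iff_inter_eq_empty]
  constructor
  · intro h
    obtain ⟨Q, hQ, hxQ, -⟩ := hK.exists_isTamePiece hx isOpen_univ (subset_univ _) h
    exact ⟨Q, hQ, hxQ⟩
  · rintro ⟨Q, hQ, hxQ⟩
    exact hQ.disjoint.mono_left (hQ.connectedComponentIn_subset hxQ)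

omit [CompactSpace M] [T2Space M] hK in
theorem uninfluencedSaddle_subset : uninfluencedSaddle φ K ⊆ uninfluenced φ K := by
  rintro x ⟨_, ⟨⟨z, hz, rfl⟩, -⟩, hx⟩
  exact connectedComponentIn_subset _ _ hx

/-! ### Finiteness and the greatest tame piece. -/

/-- Every orbit in 𝓘(K) - K enters and leaves an isolating N, so it crosses the compact frontier of
N, which finitely many (open) components cover. -/
theorem IsIsolatedNonSaddle.exists_finset_components [LocallyConnectedSpace M] :
    ∃ P : Finset M, (∀ p ∈ P, p ∈ influence φ K \ K) ∧
      ∀ x ∈ influence φ K \ K, ∃ p ∈ P, p ∈ connectedComponentIn (influence φ K \ K) x := by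
  obtain ⟨N, hNI, hN⟩ := hK.1.exists_isIsolatingNhd hK.influence_mem_nhdsSet
  have hF : frontier N ⊆ influence φ K \ K := fun x hx =>
    ⟨hNI (hN.isClosed.frontier_subset hx), fun hxK =>
      hx.2 (subset_interior_iff_mem_nhdsSet.2 hN.mem_nhdsSet hxK)⟩
  obtain ⟨P, hPF, hP⟩ := isClosed_frontier.isCompact.elim_nhds_subcover
    (fun x => connectedComponentIn (influence φ K \ K) x)
    fun x hx => connectedComponentIn_mem_nhds (hK.isOpen_influence_diff.mem_nhds (hF hx))
  refine ⟨P, fun p hp => hF (hPF p hp), fun x hx => ?_⟩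
  obtain ⟨r, hr⟩ : ∃ r, φ r x ∉ N := by
    by_contra! h
    exact hx.2 (hN.mem_of_forall h)
  obtain ⟨s, hs⟩ : ∃ s, φ s x ∈ N := by
    rcases hx.1 with h | h
    · exact (eventually_mem_of_omegaPos_subset hN.mem_nhdsSet h.2).exists
    · rw [← stableManifold_reverse] at h
      obtain ⟨s, hs⟩ := (eventually_mem_of_omegaPos_subset hN.mem_nhdsSet h.2).exists
      exact ⟨-s, hs⟩
  obtain ⟨z, hz, hzF⟩ := (isPreconnected_range_flow φ x).exists_mem_frontier
    (mem_range_self s) hs (mem_range_self r) hr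
  have hzx : z ∈ connectedComponentIn (influence φ K \ K) x := by
    refine (isPreconnected_range_flow φ x).subset_connectedComponentIn ⟨0, φ.map_zero_apply x⟩
      ?_ hz
    rintro _ ⟨t, rfl⟩
    exact ⟨isInvariant_influence t hx.1, isInvariant_compl hK.isInvariant t hx.2⟩
  obtain ⟨p, hp, hzp⟩ := mem_iUnion₂.1 (hP hzF)
  refine ⟨p, hp, ?_⟩
  rw [connectedComponentIn_eq hzx, ← connectedComponentIn_eq hzp]
  exact mem_connectedComponentIn (hF (hPF p hp))

/-- Otherwise Q would be open as well as closed, against connectedness of M. -/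
theorem IsTamePiece.exists_mem_influence_diff [ConnectedSpace M] (hKne : K.Nonempty)
    (hQ : IsTamePiece φ K Q) (hQne : Q.Nonempty) : ∃ x ∈ influence φ Q, x ∈ influence φ K \ K := by
  by_contra! h
  have hQn := hQ.isIsolatedNonSaddle hK
  have hQK := hQ.disjoint_base hK
  have heq : Q = influence φ Q ∩ ((uninfluenced φ K \ Q)ᶜ ∩ Kᶜ) := by
    ext x
    constructor
    · exact fun hx => ⟨hQn.subset_influence hx, fun h => h.2 hx, disjoint_left.1 hQK hx⟩
    · rintro ⟨h1, h2, h3⟩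
      by_contra hxQ
      exact h2 ⟨fun h4 => h x h1 ⟨h4, h3⟩, hxQ⟩
  have hopen : IsOpen Q := by
    rw [heq]
    exact hQn.isOpen_influence.inter (hQ.isClosed_diff.isOpen_compl.inter
      hK.isClosed.isOpen_compl)
  rcases isClopen_iff.1 ⟨hQ.isClosed, hopen⟩ with h | h
  · exact hQne.ne_empty h
  · obtain ⟨x, hx⟩ := hKne
    exact disjoint_left.1 hQK (h ▸ mem_univ x) hx

/-- One end of the orbit already goes to K, so only the other is available, and it cannot go to both
Q and Q'. -/
theorem IsTamePiece.disjoint_influence (hQ : IsTamePiece φ K Q) (hQ' : IsTamePiece φ K Q')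
    (h : Disjoint Q Q') (hx : x ∈ influence φ K) (hxQ : x ∈ influence φ Q) :
    x ∉ influence φ Q' := by
  intro hxQ'
  rcases hx with hx | hx
  · obtain ⟨⟨y, hy⟩, h1⟩ := hxQ.resolve_left fun h =>
      disjoint_left.1 (hQ.disjoint_stableManifold hK) h hx
    obtain ⟨-, h2⟩ := hxQ'.resolve_left fun h =>
      disjoint_left.1 (hQ'.disjoint_stableManifold hK) h hx
    exact disjoint_left.1 h (h1 hy) (h2 hy)
  · obtain ⟨⟨y, hy⟩, h1⟩ := hxQ.resolve_right fun h =>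
      disjoint_left.1 (hQ.disjoint_unstableManifold hK) h hx
    obtain ⟨-, h2⟩ := hxQ'.resolve_right fun h =>
      disjoint_left.1 (hQ'.disjoint_unstableManifold hK) h hx
    exact disjoint_left.1 h (h1 hy) (h2 hy)

theorem IsIsolatedNonSaddle.isTamePiece_biUnion (P : Finset M) {f : M → Set M}
    (hf : ∀ p, IsTamePiece φ K (f p)) : IsTamePiece φ K (⋃ p ∈ P, f p) := by
  classical
  induction P using Finset.induction_on with
  | empty => simpa using isTamePiece_empty hK.isClosed_uninfluenced
  | insert p P _ ih =>
    rw [Finset.set_biUnion_insert]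
    exact (hf p).union ih

theorem IsIsolatedNonSaddle.exists_greatest_isTamePiece [ConnectedSpace M]
    [LocallyConnectedSpace M] (hKne : K.Nonempty) :
    ∃ Q, IsTamePiece φ K Q ∧ ∀ Q', IsTamePiece φ K Q' → Q' ⊆ Q := by
  obtain ⟨P, hPI, hP⟩ := hK.exists_finset_components
  -- For each representative p, a tame piece influencing it if there is one, and ∅ otherwise. What a
  -- larger piece adds to the union of these would influence some p that is already taken by a
  -- disjoint piece.
  have hex : ∀ p, ∃ Q, IsTamePiece φ K Q ∧
      ((∃ Q', IsTamePiece φ K Q' ∧ p ∈ influence φ Q') → p ∈ influence φ Q) := by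
    intro p
    by_cases h : ∃ Q', IsTamePiece φ K Q' ∧ p ∈ influence φ Q'
    · obtain ⟨Q', h1, h2⟩ := h
      exact ⟨Q', h1, fun _ => h2⟩
    · exact ⟨∅, isTamePiece_empty hK.isClosed_uninfluenced, fun h' => absurd h' h⟩
  choose f hf hpf using hex
  have hQ := hK.isTamePiece_biUnion P hf
  refine ⟨_, hQ, fun Q' hQ' => ?_⟩
  by_contra hne
  have hd := hQ'.diff hQ
  obtain ⟨x, hx, hxK⟩ := hd.exists_mem_influence_diff hK hKne (sdiff_nonempty.2 hne)
  obtain ⟨p, hp, hpx⟩ := hP x hxK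
  have hpd := hd.subset_influence hK isPreconnected_connectedComponentIn
    (connectedComponentIn_subset _ _) ⟨x, mem_connectedComponentIn hxK, hx⟩ hpx
  refine hd.disjoint_influence hK (hf p) ?_ (hPI p hp).1 hpd (hpf p ⟨_, hd, hpd⟩)
  exact disjoint_sdiff_left.mono_right (subset_biUnion_of_mem (u := f) hp)

theorem IsIsolatedNonSaddle.isTamePiece_uninfluenced_diff [ConnectedSpace M]
    [LocallyConnectedSpace M] (hKne : K.Nonempty) :
    IsTamePiece φ K (uninfluenced φ K \ uninfluencedSaddle φ K) := by
  obtain ⟨Q, hQ, hmax⟩ := hK.exists_greatest_isTamePiece hKne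
  have : uninfluenced φ K \ uninfluencedSaddle φ K = Q := by
    ext x
    constructor
    · rintro ⟨hx, hxs⟩
      obtain ⟨Q', hQ', hxQ'⟩ := (hK.notMem_uninfluencedSaddle_iff hx).1 hxs
      exact hmax Q' hQ' hxQ'
    · intro hx
      exact ⟨hQ.subset hx, (hK.notMem_uninfluencedSaddle_iff (hQ.subset hx)).2 ⟨Q, hQ, hx⟩⟩
  rwa [this]

/-- If ω(x) met a tame Q, then x, and with it all of D, would lie in 𝓘(Q), which contains no
homoclinic point. -/
theorem IsIsolatedNonSaddle.omegaPos_subset_uninfluencedSaddle {D : Set M}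
    (hD : IsPreconnected D) (hDK : D ⊆ influence φ K \ K) (hx : x ∈ D)
    (hxA : x ∉ stableManifold φ K) (hDH : (D ∩ homoclinicPoints φ K).Nonempty) :
    omegaPos φ x ⊆ uninfluencedSaddle φ K := by
  intro y hy
  have hyL := hK.omegaPos_subset_uninfluenced hxA hy
  by_contra hys
  obtain ⟨Q, hQ, hyQ⟩ := (hK.notMem_uninfluencedSaddle_iff hyL).1 hys
  have hxQ : x ∈ influence φ Q :=
    Or.inl ((hQ.isIsolatedNonSaddle hK).mem_stableManifold_iff.2 ⟨y, hy, hyQ⟩)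
  obtain ⟨z, hzD, hz⟩ := hDH
  exact disjoint_left.1 (hQ.disjoint_influence_homoclinicPoints hK)
    (hQ.subset_influence hK hD hDK ⟨x, hx, hxQ⟩ hzD) hz

omit [CompactSpace M] [T2Space M] hK in
theorem uninfluencedSaddle_reverse :
    uninfluencedSaddle φ.reverse K = uninfluencedSaddle φ K := by
  simp only [uninfluencedSaddle, uninfluenced_reverse, isSaddle_reverse]

theorem IsIsolatedNonSaddle.omegaNeg_subset_uninfluencedSaddle {D : Set M}
    (hD : IsPreconnected D) (hDK : D ⊆ influence φ K \ K) (hx : x ∈ D)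
    (hxR : x ∉ unstableManifold φ K) (hDH : (D ∩ homoclinicPoints φ K).Nonempty) :
    omegaNeg φ x ⊆ uninfluencedSaddle φ K := by
  rw [← omegaPos_reverse, ← uninfluencedSaddle_reverse]
  exact hK.reverse.omegaPos_subset_uninfluencedSaddle hD (by rwa [influence_reverse]) hx
    (by rwa [stableManifold_reverse]) (by rwa [homoclinicPoints_reverse])

/-- With L empty, both limit sets of every point lie in K. A point x outside K then comes from
arbitrarily near K, which contradicts stability for the neighborhood {x}ᶜ. -/
theorem IsIsolatedNonSaddle.isUnstableGlobalAttractor (hKu : K ≠ univ)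
    (hL : uninfluenced φ K = ∅) : IsUnstableGlobalAttractor φ K := by
  have hA : stableManifold φ K = univ := by
    refine eq_univ_of_forall fun x => ?_
    by_contra hx
    obtain ⟨y, hy⟩ := omegaPos_nonempty φ x
    have := hK.omegaPos_subset_uninfluenced hx hy
    rw [hL] at this
    exact this
  refine ⟨hK.1, hA, fun hs => ?_⟩
  obtain ⟨x, hx⟩ := (ne_univ_iff_exists_notMem K).1 hKu
  have hxR : x ∈ stableManifold φ.reverse K := by
    rw [stableManifold_reverse]
    by_contra hx
    obtain ⟨y, hy⟩ := omegaPos_nonempty φ.reverse x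
    rw [omegaPos_reverse] at hy
    have := hK.omegaNeg_subset_uninfluenced hx hy
    rw [hL] at this
    exact this
  obtain ⟨V, hV, h⟩ := hs {x}ᶜ (isOpen_compl_singleton.mem_nhdsSet.2 (by simpa using hx))
  obtain ⟨t, htV, ht⟩ := ((eventually_mem_of_omegaPos_subset hV hxR.2).and
    (eventually_ge_atTop 0)).exists
  refine h _ htV ⟨t, ht, ?_⟩ (mem_singleton x)
  rw [Flow.reverse_apply, ← Flow.map_add, add_neg_cancel, Flow.map_zero_apply]

end Dissonant

end NonSaddle

open NonSaddle
theorem mainTheorem7 {M : Type*} [TopologicalSpace M] [CompactSpace M] [ConnectedSpace M]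
    (hM : IsANR M) (φ : Flow ℝ M) (K : Set M) (hKconn : IsConnected K) (hKne : K ≠ Set.univ)
    (hK : IsIsolatedNonSaddle φ K) :
    IsIsolatedInvariant φ (uninfluenced φ K) ∧
    (¬ IsUnstableGlobalAttractor φ K → (uninfluenced φ K).Nonempty) ∧
    (∀ C ∈ componentsOf (uninfluenced φ K),
      IsSaddle φ C ↔ (C ∩ externallyDissonant φ K).Nonempty) ∧
    (IsIsolatedInvariant φ (uninfluencedSaddle φ K) ∧
      ((uninfluencedSaddle φ K).Nonempty → IsSaddle φ (uninfluencedSaddle φ K))) ∧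
    IsIsolatedNonSaddle φ (uninfluenced φ K \ uninfluencedSaddle φ K) ∧
    (∀ x ∈ influence φ K \ K, x ∉ homoclinicPoints φ K →
      (connectedComponentIn (influence φ K \ K) x ∩ homoclinicPoints φ K).Nonempty →
      omegaPos φ x ⊆ uninfluencedSaddle φ K ∨ omegaNeg φ x ⊆ uninfluencedSaddle φ K) := by
  have := hM.locallyConnectedSpace
  have := hM.1
  have hne := hKconn.nonempty
  have hn := hK.isTamePiece_uninfluenced_diff hne
  have hs : IsClosed (uninfluencedSaddle φ K) := by
    have := hn.isClosed_diff
    rwa [sdiff_sdiff_cancel_left uninfluencedSaddle_subset] at this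
  refine ⟨hK.isIsolatedInvariant_uninfluenced, fun h => ?_, ?_, ⟨?_, ?_⟩,
    hn.isIsolatedNonSaddle hK, ?_⟩
  · by_contra hL
    exact h (hK.isUnstableGlobalAttractor hKne (not_nonempty_iff_eq_empty.1 hL))
  · rintro _ ⟨x, hx, rfl⟩
    rw [hK.isSaddle_connectedComponentIn_iff hx, hK.externallyDissonant_eq, ← inter_assoc,
      inter_eq_left.2 (connectedComponentIn_subset _ _)]
  · exact isIsolatedInvariant_of_isClosed_of_isClosed_diff hK uninfluencedSaddle_subset hs
      hn.isClosed
  · rintro ⟨x, hx⟩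
    obtain ⟨y, hy, hyH⟩ :=
      (hK.mem_uninfluencedSaddle_iff (uninfluencedSaddle_subset hx)).1 hx
    refine hK.isSaddle_of_inter_closure hs uninfluencedSaddle_subset ⟨y, ?_, hyH⟩
    have hyL := connectedComponentIn_subset _ _ hy
    rw [hK.mem_uninfluencedSaddle_iff hyL]
    exact ⟨y, mem_connectedComponentIn hyL, hyH⟩
  · intro x hx hxH hD
    by_cases hxA : x ∈ stableManifold φ K
    · exact Or.inr (hK.omegaNeg_subset_uninfluencedSaddle isPreconnected_connectedComponentIn
        (connectedComponentIn_subset _ _) (mem_connectedComponentIn hx)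
        (fun h => hxH ⟨⟨hxA, h⟩, hx.2⟩) hD)
    · exact Or.inl (hK.omegaPos_subset_uninfluencedSaddle isPreconnected_connectedComponentIn
        (connectedComponentIn_subset _ _) (mem_connectedComponentIn hx) hxA hD)
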